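/- Let $G\rightrightarrows M$ be a proper étale Lie groupoid (with $G$, $M$ smooth, Hausdorff, second countable, finite-dimensional manifolds, source $s$ and target $t$) presenting the orbifold $X=M/G$, with orbit projection $\pi:M\to X$. Let $Y\subset X$ be a closed subset and let $H\rightrightarrows N$ be a topological subgroupoid of $G\rightrightarrows M$, with $N\subset M$ closed and $\pi(N)=Y$ (for instance $N=\pi^{-1}(Y)$ and $H=G|_N$). Let $\omega$ be a closed basic $1$-form on $M$, i.e. a smooth closed $1$-form with $s^*\omega=t^*\omega$. Assume that $N$ admits a groupoid neighborhood retraction, that is: there are an open set $U\subset M$ containing $N$ and a morphism of topological groupoids $r:G|_U\to H$, where $G|_U=s^{-1}(U)\cap t^{-1}(U)\rightrightarrows U$, such that $r$ restricts to the identity on $H$ and the inclusion $G|_U\to G$ is homotopic to $r$ followed by the inclusion $H\to G$ through a continuous family $D:[0,1]\times G|_U\to G$ of groupoid morphisms $D_\tau:G|_U\to G$. Then the following two conditions are equivalent: (2) there is a smooth function $\overline f:\tilde U\to\mathbb R$ on an open neighborhood $\tilde U\subset X$ of $Y$ (smooth meaning that $f=\overline f\circ\pi$ is smooth on $\pi^{-1}(\tilde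 U)$) such that $\omega=df$ on $\pi^{-1}(\tilde U)$ and $df=0$ at every point of $\pi^{-1}(Y)$; (2') $\omega_x=0$ for every $x\in N$. -/

import Mathlib

open scoped Manifold ContDiff

/-- A (Hausdorffness, second countability and finite dimension are left to the type class
assumptions) étale Lie groupoid with arrow manifold `G` and object manifold `M`, both modelled on
`E`. The product `mul g h` (first `h`, then `g`) is meaningful only for composable pairs,
`src g = tgt h`; its values on other pairs are irrelevant. -/
structure EtaleLieGroupoid (E : Type*) [NormedAddCommGroup E] [NormedSpace ℝ E]
    (G : Type*) [TopologicalSpace G] [ChartedSpace E G]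
    (M : Type*) [TopologicalSpace M] [ChartedSpace E M] where
  src : G → M
  tgt : G → M
  mul : G → G → G
  one : M → G
  inv : G → G
  src_mul : ∀ g h, src g = tgt h → src (mul g h) = src h
  tgt_mul : ∀ g h, src g = tgt h → tgt (mul g h) = tgt g
  mul_assoc : ∀ g h k, src g = tgt h → src h = tgt k → mul (mul g h) k = mul g (mul h k)
  src_one : ∀ x, src (one x) = x
  tgt_one : ∀ x, tgt (one x) = x
  one_mul : ∀ g, mul (one (tgt g)) g = g
  mul_one : ∀ g, mul g (one (src g)) = g
  src_inv : ∀ g, src (inv g) = tgt g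
  tgt_inv : ∀ g, tgt (inv g) = src g
  inv_mul : ∀ g, mul (inv g) g = one (src g)
  mul_inv : ∀ g, mul g (inv g) = one (tgt g)
  contMDiff_src : ContMDiff 𝓘(ℝ, E) 𝓘(ℝ, E) ∞ src
  contMDiff_tgt : ContMDiff 𝓘(ℝ, E) 𝓘(ℝ, E) ∞ tgt
  contMDiff_one : ContMDiff 𝓘(ℝ, E) 𝓘(ℝ, E) ∞ one
  contMDiff_inv : ContMDiff 𝓘(ℝ, E) 𝓘(ℝ, E) ∞ inv
  contMDiffOn_mul : ContMDiffOn (𝓘(ℝ, E).prod 𝓘(ℝ, E)) 𝓘(ℝ, E) ∞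
    (fun p : G × G => mul p.1 p.2) {p | src p.1 = tgt p.2}
  isLocalDiffeomorph_src : IsLocalDiffeomorph 𝓘(ℝ, E) 𝓘(ℝ, E) ∞ src

namespace EtaleLieGroupoid

variable {E : Type*} [NormedAddCommGroup E] [NormedSpace ℝ E]
  {G : Type*} [TopologicalSpace G] [ChartedSpace E G]
  {M : Type*} [TopologicalSpace M] [ChartedSpace E M]

/-- The groupoid is proper: `(src, tgt) : G → M × M` is a proper map. -/
def IsProper (𝒢 : EtaleLieGroupoid E G M) : Prop :=
  IsProperMap (fun g : G => (𝒢.src g, 𝒢.tgt g))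

/-- Two objects are equivalent when an arrow joins them. -/
def orbitSetoid (𝒢 : EtaleLieGroupoid E G M) : Setoid M where
  r x y := ∃ g : G, 𝒢.src g = x ∧ 𝒢.tgt g = y
  iseqv :=
    { refl := fun x => ⟨𝒢.one x, 𝒢.src_one x, 𝒢.tgt_one x⟩
      symm := by
        rintro x y ⟨g, hx, hy⟩
        exact ⟨𝒢.inv g, (𝒢.src_inv g).trans hy, (𝒢.tgt_inv g).trans hx⟩
      trans := by
        rintro x y z ⟨g, hx, hy⟩ ⟨h, hy', hz⟩
        have hc : 𝒢.src h = 𝒢.tgt g := hy'.trans hy.symm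
        exact ⟨𝒢.mul h g, (𝒢.src_mul h g hc).trans hx, (𝒢.tgt_mul h g hc).trans hz⟩ }

/-- The orbit space `X = M / G`, with the quotient topology. -/
def OrbitSpace (𝒢 : EtaleLieGroupoid E G M) : Type _ := Quotient 𝒢.orbitSetoid

instance (𝒢 : EtaleLieGroupoid E G M) : TopologicalSpace 𝒢.OrbitSpace :=
  inferInstanceAs (TopologicalSpace (Quotient 𝒢.orbitSetoid))

/-- The orbit projection `π : M → X`. -/
def proj (𝒢 : EtaleLieGroupoid E G M) (x : M) : 𝒢.OrbitSpace := Quotient.mk 𝒢.orbitSetoid x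

/-! ### Topological subgroupoids and their morphisms -/

/-- A subgroupoid `arrows ⇉ objs` of `G ⇉ M`; it carries the subspace topologies. -/
structure Subgroupoid (𝒢 : EtaleLieGroupoid E G M) where
  objs : Set M
  arrows : Set G
  src_mem : ∀ g ∈ arrows, 𝒢.src g ∈ objs
  tgt_mem : ∀ g ∈ arrows, 𝒢.tgt g ∈ objs
  one_mem : ∀ x ∈ objs, 𝒢.one x ∈ arrows
  inv_mem : ∀ g ∈ arrows, 𝒢.inv g ∈ arrows
  mul_mem : ∀ g ∈ arrows, ∀ h ∈ arrows, 𝒢.src g = 𝒢.tgt h → 𝒢.mul g h ∈ arrows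

variable {𝒢 : EtaleLieGroupoid E G M}

/-- The restriction `G|_U ⇉ U`, whose arrows are all those with source and target in `U`. -/
def restrict (𝒢 : EtaleLieGroupoid E G M) (U : Set M) : 𝒢.Subgroupoid where
  objs := U
  arrows := {g | 𝒢.src g ∈ U ∧ 𝒢.tgt g ∈ U}
  src_mem _ hg := hg.1
  tgt_mem _ hg := hg.2
  one_mem x hx := ⟨(𝒢.src_one x).symm ▸ hx, (𝒢.tgt_one x).symm ▸ hx⟩
  inv_mem g hg := ⟨(𝒢.src_inv g).symm ▸ hg.2, (𝒢.tgt_inv g).symm ▸ hg.1⟩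
  mul_mem g hg h hh hc := ⟨(𝒢.src_mul g h hc).symm ▸ hh.1, (𝒢.tgt_mul g h hc).symm ▸ hg.2⟩

/-- The whole groupoid `G ⇉ M`, as a subgroupoid of itself. -/
def whole (𝒢 : EtaleLieGroupoid E G M) : 𝒢.Subgroupoid := 𝒢.restrict Set.univ

namespace Subgroupoid

/-- A morphism of topological groupoids: a continuous functor. (Preservation of units and
inverses follows from preservation of products.) -/
structure Hom (K L : 𝒢.Subgroupoid) where
  obj : K.objs → L.objs
  map : K.arrows → L.arrows
  continuous_obj : Continuous obj
  continuous_map : Continuous map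
  src_map : ∀ g : K.arrows, 𝒢.src (map g : G) = obj ⟨𝒢.src (g : G), K.src_mem g g.2⟩
  tgt_map : ∀ g : K.arrows, 𝒢.tgt (map g : G) = obj ⟨𝒢.tgt (g : G), K.tgt_mem g g.2⟩
  map_mul : ∀ (g h : K.arrows) (hc : 𝒢.src (g : G) = 𝒢.tgt (h : G)),
    (map ⟨𝒢.mul g h, K.mul_mem g g.2 h h.2 hc⟩ : G) = 𝒢.mul (map g) (map h)

/-- The identity morphism. -/
def Hom.id (K : 𝒢.Subgroupoid) : K.Hom K where
  obj x := x
  map g := g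
  continuous_obj := continuous_id
  continuous_map := continuous_id
  src_map _ := rfl
  tgt_map _ := rfl
  map_mul _ _ _ := rfl

/-- Composition of morphisms, `ψ ∘ φ`. -/
def Hom.comp {K L P : 𝒢.Subgroupoid} (ψ : L.Hom P) (φ : K.Hom L) : K.Hom P where
  obj x := ψ.obj (φ.obj x)
  map g := ψ.map (φ.map g)
  continuous_obj := ψ.continuous_obj.comp φ.continuous_obj
  continuous_map := ψ.continuous_map.comp φ.continuous_map
  src_map g := by
    rw [ψ.src_map]
    exact congrArg (fun x => (ψ.obj x : M)) (Subtype.ext (φ.src_map g))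
  tgt_map g := by
    rw [ψ.tgt_map]
    exact congrArg (fun x => (ψ.obj x : M)) (Subtype.ext (φ.tgt_map g))
  map_mul g h hc := by
    have hc' : 𝒢.src (φ.map g : G) = 𝒢.tgt (φ.map h : G) := by
      rw [φ.src_map, φ.tgt_map]
      exact congrArg (fun x => (φ.obj x : M)) (Subtype.ext hc)
    rw [← ψ.map_mul (φ.map g) (φ.map h) hc']
    exact congrArg (fun x => (ψ.map x : G)) (Subtype.ext (φ.map_mul g h hc))

/-- The inclusion morphism of a subgroupoid into a larger one. -/
def inclusion {K L : 𝒢.Subgroupoid} (ho : K.objs ⊆ L.objs) (ha : K.arrows ⊆ L.arrows) :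
    K.Hom L where
  obj := Set.inclusion ho
  map := Set.inclusion ha
  continuous_obj := continuous_inclusion ho
  continuous_map := continuous_inclusion ha
  src_map _ := rfl
  tgt_map _ := rfl
  map_mul _ _ _ := rfl

/-- The inclusion of a subgroupoid into `G ⇉ M`. -/
def incl (K : 𝒢.Subgroupoid) : K.Hom 𝒢.whole :=
  inclusion (Set.subset_univ _) (fun _ _ => ⟨Set.mem_univ _, Set.mem_univ _⟩)

/-- The inclusion of `H ⇉ N` into `G|_U ⇉ U`, for `N ⊆ U`. -/
def inclRestrict (H : 𝒢.Subgroupoid) {U : Set M} (hU : H.objs ⊆ U) : H.Hom (𝒢.restrict U) :=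
  inclusion hU (fun g hg => ⟨hU (H.src_mem g hg), hU (H.tgt_mem g hg)⟩)

/-- Groupoid homotopy: a continuous one-parameter family of groupoid morphisms
`D : [0,1] × K → L` from `φ` to `ψ`. -/
def Hom.Homotopic {K L : 𝒢.Subgroupoid} (φ ψ : K.Hom L) : Prop :=
  ∃ D : unitInterval → K.Hom L,
    Continuous (fun p : unitInterval × K.arrows => (D p.1).map p.2) ∧ D 0 = φ ∧ D 1 = ψ

/-- `H ⇉ N` admits a groupoid neighborhood retraction: there are an open `U ⊇ N` and a groupoid
retraction `r : G|_U → H` such that the inclusion `G|_U → G` is groupoid homotopic to `r` followed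
by the inclusion `H → G`. -/
def AdmitsNeighborhoodRetraction (H : 𝒢.Subgroupoid) : Prop :=
  ∃ (U : Set M) (hU : H.objs ⊆ U), IsOpen U ∧
    ∃ r : (𝒢.restrict U).Hom H,
      r.comp (H.inclRestrict hU) = Hom.id H ∧
      ((𝒢.restrict U).incl).Homotopic (H.incl.comp r)

end Subgroupoid

/-! ### Differential 1-forms -/

/-- `η` is smooth, as a section of the cotangent bundle of `M`. -/
def IsSmoothForm [IsManifold 𝓘(ℝ, E) ∞ M]
    (η : ∀ x : M, TangentSpace 𝓘(ℝ, E) x →L[ℝ] ℝ) : Prop :=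
  ContMDiff 𝓘(ℝ, E) (𝓘(ℝ, E).prod 𝓘(ℝ, E →L[ℝ] ℝ)) ∞
    (fun x => Bundle.TotalSpace.mk' (E →L[ℝ] ℝ)
      (E := fun x : M => TangentSpace 𝓘(ℝ, E) x →L[ℝ] ℝ) x (η x))

/-- The coordinate expression `(e⁻¹)^* η` of a 1-form in a chart `e`; meaningful on `e.target`. -/
noncomputable def formInChart (η : ∀ x : M, TangentSpace 𝓘(ℝ, E) x →L[ℝ] ℝ)
    (e : OpenPartialHomeomorph M E) (y : E) : E →L[ℝ] ℝ :=
  (η (e.symm y)).comp (mfderiv 𝓘(ℝ, E) 𝓘(ℝ, E) e.symm y)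

/-- `dη = 0`: in each chart the exterior derivative of the coordinate expression vanishes. -/
def IsClosedForm (η : ∀ x : M, TangentSpace 𝓘(ℝ, E) x →L[ℝ] ℝ) : Prop :=
  ∀ e ∈ atlas E M, ∀ y ∈ e.target,
    extDeriv (fun z : E => ContinuousAlternatingMap.ofSubsingleton ℝ E ℝ (0 : Fin 1)
      (formInChart η e z)) y = 0

/-- `η` is basic: `tgt^* η = src^* η`. -/
def IsBasicForm (𝒢 : EtaleLieGroupoid E G M)
    (η : ∀ x : M, TangentSpace 𝓘(ℝ, E) x →L[ℝ] ℝ) : Prop :=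
  ∀ g : G, (η (𝒢.tgt g)).comp (mfderiv 𝓘(ℝ, E) 𝓘(ℝ, E) 𝒢.tgt g) =
    (η (𝒢.src g)).comp (mfderiv 𝓘(ℝ, E) 𝓘(ℝ, E) 𝒢.src g)

/-- There is a smooth function `f` on an open neighborhood `V` of `Y` in the orbit space with
`η = df` on `V` and `df = 0` at the points of `Y`. Functions and forms on the orbit space are
represented by their pull-backs along `π`, the basic functions and basic forms. -/
def IsLocallyExactVanishing (𝒢 : EtaleLieGroupoid E G M)
    (η : ∀ x : M, TangentSpace 𝓘(ℝ, E) x →L[ℝ] ℝ) (Y : Set 𝒢.OrbitSpace) : Prop :=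
  ∃ V : Set 𝒢.OrbitSpace, IsOpen V ∧ Y ⊆ V ∧ ∃ f : 𝒢.OrbitSpace → ℝ,
    ContMDiffOn 𝓘(ℝ, E) 𝓘(ℝ, ℝ) ∞ (f ∘ 𝒢.proj) (𝒢.proj ⁻¹' V) ∧
    (∀ x ∈ 𝒢.proj ⁻¹' V, η x = mvfderiv 𝓘(ℝ, E) (f ∘ 𝒢.proj) x) ∧
    (∀ x ∈ 𝒢.proj ⁻¹' Y, mvfderiv 𝓘(ℝ, E) (f ∘ 𝒢.proj) x = 0)

end EtaleLieGroupoid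

/-! ### The Morse–Sard theorem for real-valued functions -/

section MorseSard

open MeasureTheory Set Topology

/-! If $\omega=df$ near $\pi^{-1}(Y)$ and $df=0$ there, then $\omega$ vanishes on $N$. The content
is the converse: constructing an invariant primitive near $N$.

Local primitives of $\omega$ on $M$ differ by locally constant functions, so their germs form a
covering space of $M$. Reversed in time, the homotopy $D$ moves each $x\in U$ from $r(x)\in N$ to
$x$. Lifting this motion to the covering, from germs vanishing at $r(x)$, gives a function $h$ on
$[0,1]\times U$ whose end value $f=h(1,\cdot)$ satisfies $df=\omega$
(`exists_potential_along_homotopy`).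

The initial germs depend continuously on $x$ only if each local primitive $F$ is locally constant
along $r$. Since $r$ is merely continuous and $N$ an arbitrary closed set, $F\circ r$ cannot be
differentiated. But $N$ consists of critical points of $F$, so by Morse–Sard $F\circ r$ takes values
in a null set. It is also continuous, hence constant on connected sets.

For invariance, follow an arrow $g$ along the homotopy. As $\omega$ is basic, $F_1\circ t-F_2\circ
s$ is locally constant on $G$, so $h(\tau,t(g))-h(\tau,s(g))$ does not depend on $\tau$; it is $0$
at the start. The étale property then lets $f$ descend to the open set $\pi(U)$. -/

lemma Convex.norm_image_sub_le_mul_pow_succ {E V : Type*} [NormedAddCommGroup E]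
    [NormedSpace ℝ E] [NormedAddCommGroup V] [NormedSpace ℝ V] {g : E → V} {s : Set E}
    (hs : Convex ℝ s) {C : ℝ} {i : ℕ} {x : E} (hx : x ∈ s)
    (hg : ∀ y ∈ s, DifferentiableAt ℝ g y) (bound : ∀ y ∈ s, ‖fderiv ℝ g y‖ ≤ C * ‖y - x‖ ^ i)
    {y : E} (hy : y ∈ s) : ‖g y - g x‖ ≤ C * ‖y - x‖ ^ (i + 1) := by
  by_cases hyx : y = x
  · simp [hyx]
  have hpos : 0 < ‖y - x‖ := norm_pos_iff.2 (sub_ne_zero.2 hyx)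
  have hC : 0 ≤ C := by
    have := (norm_nonneg _).trans (bound y hy)
    exact nonneg_of_mul_nonneg_left this (pow_pos hpos i)
  have hsub : segment ℝ x y ⊆ s := hs.segment_subset hx hy
  have key := (convex_segment x y).norm_image_sub_le_of_norm_fderiv_le
    (f := g) (𝕜 := ℝ) (C := C * ‖y - x‖ ^ i) (fun z hz => hg z (hsub hz))
    (fun z hz => (bound z (hsub hz)).trans (by
      have : ‖z - x‖ ≤ ‖y - x‖ := norm_sub_le_of_mem_segment hz
      gcongr)) (left_mem_segment ℝ x y) (right_mem_segment ℝ x y)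
  rwa [pow_succ, ← mul_assoc]

/-- A function whose derivatives of orders `1, …, k` vanish at `x` is constant up to order
`k + 1` near `x`. -/
lemma Convex.norm_image_sub_le_of_iteratedFDeriv_eq_zero {E V : Type*} [NormedAddCommGroup E]
    [NormedSpace ℝ E] [NormedAddCommGroup V] [NormedSpace ℝ V] {f : E → V} {s : Set E}
    (hs : Convex ℝ s) {k : ℕ} {C : ℝ} {x : E} (hx : x ∈ s)
    (hf : ∀ y ∈ s, ContDiffAt ℝ (k + 1) f y)
    (bound : ∀ y ∈ s, ‖iteratedFDeriv ℝ (k + 1) f y‖ ≤ C)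
    (h0 : ∀ j, 1 ≤ j → j ≤ k → iteratedFDeriv ℝ j f x = 0) {y : E} (hy : y ∈ s) :
    ‖f y - f x‖ ≤ C * ‖y - x‖ ^ (k + 1) := by
  -- The bound of order `k + 1` is integrated downwards: each lower derivative vanishes at `x`, so
  -- one integration gains one power of `‖y - x‖`.
  have key : ∀ i j, i + j = k → ∀ y ∈ s, ‖iteratedFDeriv ℝ (j + 1) f y‖ ≤ C * ‖y - x‖ ^ i := by
    intro i
    induction i with
    | zero =>
      intro j hj y hy
      obtain rfl : j = k := by omega
      simpa using bound y hy
    | succ i ih =>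
      intro j hj y hy
      have h := hs.norm_image_sub_le_mul_pow_succ (g := iteratedFDeriv ℝ (j + 1) f) hx
        (fun z hz => (hf z hz).differentiableAt_iteratedFDeriv (by
          have : j + 1 < k + 1 := by omega
          exact_mod_cast this))
        (fun z hz => by
          rw [norm_fderiv_iteratedFDeriv]
          exact ih (j + 1) (by omega) z hz) hy
      rwa [h0 (j + 1) (by omega) (by omega), sub_zero] at h
  refine hs.norm_image_sub_le_mul_pow_succ hx
    (fun z hz => (hf z hz).differentiableAt (by simp)) (fun z hz => ?_) hy
  rw [← norm_iteratedFDeriv_one]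
  exact key k 0 (by omega) z hz

/-- The image of the set of points where the derivatives of orders `1, …, dim E` vanish is a null
set. -/
lemma volume_image_iteratedFDeriv_eq_zero {E : Type*} [NormedAddCommGroup E] [NormedSpace ℝ E]
    [FiniteDimensional ℝ E] {f : E → ℝ} {U : Set E} (hU : IsOpen U)
    (hf : ContDiffOn ℝ ∞ f U) :
    volume (f '' {x ∈ U | ∀ j, 1 ≤ j → j ≤ Module.finrank ℝ E → iteratedFDeriv ℝ j f x = 0})
      = 0 := by
  set n := Module.finrank ℝ E
  set S := {x ∈ U | ∀ j, 1 ≤ j → j ≤ n → iteratedFDeriv ℝ j f x = 0}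
  -- Any point of `S` may serve as the centre of the Taylor estimate, so `f` is locally Hölder of
  -- exponent `n + 1` on `S`. This gives dimension at most `n / (n + 1) < 1` for the image.
  have hd : dimH (f '' S) ≤ dimH S / ((n + 1 : ℕ) : NNReal) := by
    refine dimH_image_le_of_locally_holder_on (by positivity) fun x hx => ?_
    have hfx : ContDiffAt ℝ ∞ f x := hf.contDiffAt (hU.mem_nhds hx.1)
    have hc : ContinuousAt (fun y => ‖iteratedFDeriv ℝ (n + 1) f y‖) x :=
      (hfx.continuousAt_iteratedFDeriv (k := n + 1) (by exact_mod_cast le_top)).norm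
    have hev : ∀ᶠ y in 𝓝 x, ‖iteratedFDeriv ℝ (n + 1) f y‖ < ‖iteratedFDeriv ℝ (n + 1) f x‖ + 1 :=
      hc.eventually_lt continuousAt_const (by simp)
    obtain ⟨ε, hε, hball⟩ := Metric.eventually_nhds_iff_ball.1 (hev.and (hU.mem_nhds hx.1))
    refine ⟨(‖iteratedFDeriv ℝ (n + 1) f x‖ + 1).toNNReal, S ∩ Metric.ball x ε,
      inter_mem_nhdsWithin _ (Metric.ball_mem_nhds x hε), ?_⟩
    intro a ha b hb
    have hle := (convex_ball x ε).norm_image_sub_le_of_iteratedFDeriv_eq_zero (f := f) (k := n)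
      (C := ‖iteratedFDeriv ℝ (n + 1) f x‖ + 1) ha.2
      (fun y hy => (hf.contDiffAt (hU.mem_nhds (hball y hy).2)).of_le (by exact_mod_cast le_top))
      (fun y hy => (hball y hy).1.le) ha.1.2 hb.2
    rw [edist_comm, edist_comm a, edist_dist, edist_dist, dist_eq_norm, dist_eq_norm,
      ENNReal.ofReal_rpow_of_nonneg (norm_nonneg _) (by positivity)]
    change _ ≤ ENNReal.ofReal _ * _
    rw [← ENNReal.ofReal_mul (by positivity)]
    refine ENNReal.ofReal_le_ofReal ?_
    rw [NNReal.coe_natCast, Real.rpow_natCast]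
    exact hle
  have hlt : dimH (f '' S) < (1 : NNReal) := by
    refine hd.trans_lt ?_
    have h1 : dimH S ≤ n := (dimH_mono (subset_univ _)).trans (Real.dimH_univ_eq_finrank E).le
    refine ENNReal.div_lt_of_lt_mul ?_
    refine h1.trans_lt ?_
    rw [ENNReal.coe_one, one_mul]
    exact_mod_cast Nat.lt_succ_self n
  have := hausdorffMeasure_of_dimH_lt hlt
  rwa [NNReal.coe_one, hausdorffMeasure_real] at this

/-- A subset is mapped to a null set when it is locally so. -/
lemma measure_image_eq_zero_of_locally {X Y : Type*} [TopologicalSpace X]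
    [SecondCountableTopology X] [MeasurableSpace Y] {μ : Measure Y} {f : X → Y} {S : Set X}
    (h : ∀ x ∈ S, ∃ W ∈ 𝓝 x, μ (f '' (S ∩ W)) = 0) : μ (f '' S) = 0 := by
  choose! W hW hμ using h
  obtain ⟨t, htS, htc, hcov⟩ := TopologicalSpace.countable_cover_nhdsWithin
    (fun x hx => mem_nhdsWithin_of_mem_nhds (hW x hx) : ∀ x ∈ S, W x ∈ 𝓝[S] x)
  have hsub : f '' S ⊆ ⋃ x ∈ t, f '' (S ∩ W x) := by
    rintro _ ⟨y, hy, rfl⟩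
    obtain ⟨x, hx, hyx⟩ := mem_iUnion₂.1 (hcov hy)
    exact mem_iUnion₂.2 ⟨x, hx, y, ⟨hy, hyx⟩, rfl⟩
  exact measure_mono_null hsub ((measure_biUnion_null_iff htc).2 fun x hx => hμ x (htS hx))

/-- Near a point where `g` vanishes and has nonzero derivative, the zero set of `g` is smoothly
parametrized by an open set of the hyperplane `ker (dg)`. -/
lemma exists_parametrization_zero_set {E : Type*} [NormedAddCommGroup E] [NormedSpace ℝ E]
    [FiniteDimensional ℝ E] {g : E → ℝ} {U : Set E} (hU : IsOpen U) (hg : ContDiffOn ℝ ∞ g U)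
    {x : E} (hx : x ∈ U) (hdg : fderiv ℝ g x ≠ 0) :
    ∃ W ∈ 𝓝 x, ∃ (V : Set (fderiv ℝ g x).ker) (φ : (fderiv ℝ g x).ker → E), IsOpen V ∧
      ContDiffOn ℝ ∞ φ V ∧ MapsTo φ V U ∧ ∀ y ∈ W, g y = 0 → ∃ z ∈ V, φ z = y := by
  have : CompleteSpace E := FiniteDimensional.complete ℝ E
  set L := fderiv ℝ g x
  obtain ⟨v, hv⟩ : ∃ v, L v = 1 := by
    obtain ⟨w, hw⟩ : ∃ w, L w ≠ 0 := by
      by_contra! h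
      exact hdg (ContinuousLinearMap.ext h)
    exact ⟨(L w)⁻¹ • w, by simp [hw]⟩
  -- Since `L v = 1`, one has `L (ψ y - x) = g y`: the map `ψ` straightens the zero set of `g` into
  -- `x + ker L`. Its derivative at `x` is the identity.
  set ψ : E → E := fun y => y + (g y - L (y - x)) • v
  have hψU : ContDiffOn ℝ ∞ ψ U := by
    have hL : ContDiff ℝ ∞ fun y => L (y - x) := L.contDiff.comp (contDiff_id.sub contDiff_const)
    exact contDiff_id.contDiffOn.add ((hg.sub hL.contDiffOn).smul contDiffOn_const)
  have hψat : ∀ y ∈ U, ContDiffAt ℝ ∞ ψ y := fun y hy => hψU.contDiffAt (hU.mem_nhds hy)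
  have hψx : HasFDerivAt ψ ((ContinuousLinearEquiv.refl ℝ E : E ≃L[ℝ] E) : E →L[ℝ] E) x := by
    have h1 : HasFDerivAt g L x :=
      ((hg.contDiffAt (hU.mem_nhds hx)).differentiableAt (by simp)).hasFDerivAt
    have h2 : HasFDerivAt (fun y => L (y - x)) L x := by
      exact L.hasFDerivAt.comp x ((hasFDerivAt_id x).sub_const x)
    have h3 := (hasFDerivAt_id x).add ((h1.sub h2).smul_const v)
    convert! h3 using 1
    ext w
    simp
  have hne : (∞ : WithTop ℕ∞) ≠ 0 := by simp
  set Φ := (hψat x hx).toOpenPartialHomeomorph ψ hψx hne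
  have hΦ : (Φ : E → E) = ψ := (hψat x hx).toOpenPartialHomeomorph_coe hψx hne
  have hxΦ : x ∈ Φ.source := (hψat x hx).mem_toOpenPartialHomeomorph_source hψx hne
  have hcont : ContinuousAt (fderiv ℝ ψ) x :=
    ((hψat x hx).fderiv_right (m := 0) (by simp)).continuousAt
  -- The parametrization must be smooth on an open set, not only at one point, so the domain is cut
  -- down to where `fderiv ℝ ψ` is invertible.
  have hinv : ∀ᶠ y in 𝓝 x, fderiv ℝ ψ y ∈ range ((↑) : (E ≃L[ℝ] E) → E →L[ℝ] E) := by
    refine hcont.eventually ?_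
    rw [hψx.fderiv]
    exact ContinuousLinearEquiv.nhds _
  obtain ⟨W, hW, hWo, hxW⟩ := eventually_nhds_iff.1
    (hinv.and ((hU.eventually_mem hx).and (Φ.open_source.eventually_mem hxΦ)))
  have hT : IsOpen (Φ.target ∩ Φ.symm ⁻¹' W) := Φ.symm.isOpen_inter_preimage hWo
  refine ⟨W, hWo.mem_nhds hxW, (fun z : L.ker => x + (z : E)) ⁻¹' (Φ.target ∩ Φ.symm ⁻¹' W),
    fun z => Φ.symm (x + (z : E)), hT.preimage (by fun_prop), ?_, fun z hz => (hW _ hz.2).2.1, ?_⟩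
  · intro z hz
    obtain ⟨e, he⟩ := (hW _ hz.2).1
    have h1 : ContDiffAt ℝ ∞ Φ.symm (x + (z : E)) := by
      refine Φ.contDiffAt_symm (f₀' := e) hz.1 ?_ ?_
      · rw [hΦ, he]
        exact ((hψat _ (hW _ hz.2).2.1).differentiableAt (by simp)).hasFDerivAt
      · rw [hΦ]
        exact hψat _ (hW _ hz.2).2.1
    have h2 : ContDiff ℝ ∞ fun z : L.ker => x + (z : E) :=
      contDiff_const.add L.ker.subtypeL.contDiff
    exact (h1.comp z h2.contDiffAt).contDiffWithinAt
  · intro y hy hgy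
    have hys : y ∈ Φ.source := (hW y hy).2.2
    have hker : ψ y - x ∈ L.ker := by
      simp [ψ, LinearMap.mem_ker, hgy, hv]
    have hsum : x + (ψ y - x) = Φ y := by rw [hΦ]; abel
    refine ⟨⟨ψ y - x, hker⟩, ⟨?_, ?_⟩, ?_⟩
    · simp only [hsum]; exact Φ.map_source hys
    · simp only [mem_preimage, hsum, Φ.left_inv hys]; exact hy
    · simp only [hsum, Φ.left_inv hys]

/-- **Morse–Sard theorem** for a smooth real-valued function on an open set of a finite dimensional
space: the set of critical values is a null set. -/
theorem volume_image_fderiv_eq_zero {E : Type*} [NormedAddCommGroup E] [NormedSpace ℝ E]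
    [FiniteDimensional ℝ E] {f : E → ℝ} {U : Set E} (hU : IsOpen U)
    (hf : ContDiffOn ℝ ∞ f U) : volume (f '' {x ∈ U | fderiv ℝ f x = 0}) = 0 := by
  obtain ⟨n, hn⟩ : ∃ n, Module.finrank ℝ E = n := ⟨_, rfl⟩
  induction n using Nat.strong_induction_on generalizing E with
  | _ n ih =>
  have : SecondCountableTopology E := by
    have := FiniteDimensional.proper ℝ E
    infer_instance
  -- Stratification by the order `k + 1` of the first nonzero derivative. With `k ≥ 1` these strata
  -- lie locally in hypersurfaces; the points that are flat to order `finrank ℝ E` are handled by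
  -- the Hölder estimate.
  set T : ℕ → Set E := fun k =>
    {x ∈ U | (∀ j, 1 ≤ j → j ≤ k → iteratedFDeriv ℝ j f x = 0) ∧ iteratedFDeriv ℝ (k + 1) f x ≠ 0}
  have hcover : {x ∈ U | fderiv ℝ f x = 0} ⊆
      {x ∈ U | ∀ j, 1 ≤ j → j ≤ Module.finrank ℝ E → iteratedFDeriv ℝ j f x = 0} ∪
        ⋃ k, ⋃ (_ : 1 ≤ k), T k := by
    intro x hx
    classical
    by_cases h : ∃ j, 1 ≤ j ∧ iteratedFDeriv ℝ j f x ≠ 0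
    · right
      have hs := Nat.find_spec h
      have hmin : ∀ j, 1 ≤ j → j < Nat.find h → iteratedFDeriv ℝ j f x = 0 := by
        intro j hj hlt
        by_contra hc
        exact Nat.find_min h hlt ⟨hj, hc⟩
      have h1 : Nat.find h ≠ 1 := by
        intro h1
        rw [h1] at hs
        exact hs.2 (norm_eq_zero.1 (by rw [norm_iteratedFDeriv_one, hx.2, norm_zero]))
      refine mem_iUnion₂.2 ⟨Nat.find h - 1, by omega, hx.1, fun j hj hle => hmin j hj (by omega), ?_⟩
      rw [Nat.sub_add_cancel hs.1]
      exact hs.2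
    · left
      push Not at h
      exact ⟨hx.1, fun j hj _ => h j hj⟩
  refine measure_mono_null (image_mono hcover) ?_
  rw [image_union, image_iUnion₂]
  refine measure_union_null (volume_image_iteratedFDeriv_eq_zero hU hf) ?_
  refine (measure_iUnion_null fun k => measure_iUnion_null fun hk => ?_)
  refine measure_image_eq_zero_of_locally fun x hx => ?_
  have hD : ∀ y ∈ U, ContDiffAt ℝ ∞ (iteratedFDeriv ℝ k f) y := fun y hy =>
    (hf.contDiffAt (hU.mem_nhds hy)).iteratedFDeriv_right (m := ∞) (by exact_mod_cast le_top)
  obtain ⟨m, hm⟩ : ∃ m, iteratedFDeriv ℝ (k + 1) f x m ≠ 0 := by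
    by_contra! h
    exact hx.2.2 (ContinuousMultilinearMap.ext h)
  -- Fixing all but the first vector of `m` yields a `k`-th directional derivative `g` of `f`, zero
  -- on `T k` because `k ≥ 1`, with nonzero derivative at `x` in the direction `m 0`.
  set ev := ContinuousMultilinearMap.apply ℝ (fun _ : Fin k => E) ℝ (Fin.tail m)
  set g : E → ℝ := fun y => ev (iteratedFDeriv ℝ k f y)
  have hg : ContDiffOn ℝ ∞ g U := fun y hy =>
    (ev.contDiff.contDiffAt.comp y (hD y hy)).contDiffWithinAt
  have hdg : fderiv ℝ g x ≠ 0 := by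
    intro h
    apply hm
    have h1 : HasFDerivAt g (ev.comp (fderiv ℝ (iteratedFDeriv ℝ k f) x)) x :=
      ev.hasFDerivAt.comp x ((hD x hx.1).differentiableAt (by simp)).hasFDerivAt
    rw [h1.fderiv] at h
    rw [iteratedFDeriv_succ_apply_left]
    simpa [ev] using DFunLike.congr_fun h (m 0)
  obtain ⟨W, hW, V, φ, hV, hφ, hφU, hsurj⟩ := exists_parametrization_zero_set hU hg hx.1 hdg
  have hrank : Module.finrank ℝ (fderiv ℝ g x).ker < n := by
    rw [← hn]
    refine Submodule.finrank_lt fun h => hdg ?_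
    ext w
    have : w ∈ (fderiv ℝ g x).ker := h ▸ Submodule.mem_top
    simpa using this
  -- Points of `T k` near `x` are critical for `f`, so their parameters are critical for `f ∘ φ`,
  -- which lives in smaller dimension.
  refine ⟨W, hW, measure_mono_null ?_
    (ih _ hrank (f := f ∘ φ) hV (hf.comp hφ hφU) rfl)⟩
  rintro _ ⟨y, ⟨hy, hyW⟩, rfl⟩
  have hgy : g y = 0 := by simp [g, hy.2.1 k hk le_rfl]
  obtain ⟨z, hz, rfl⟩ := hsurj y hyW hgy
  refine ⟨z, ⟨hz, ?_⟩, rfl⟩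
  have hcrit : fderiv ℝ f (φ z) = 0 :=
    norm_eq_zero.1 (by rw [← norm_iteratedFDeriv_one, hy.2.1 1 le_rfl hk, norm_zero])
  rw [fderiv_comp z ((hf.contDiffAt (hU.mem_nhds hy.1)).differentiableAt (by simp))
    ((hφ.contDiffAt (hV.mem_nhds hz)).differentiableAt (by simp)), hcrit,
    ContinuousLinearMap.zero_comp]

end MorseSard

/-! ### Analytic continuation of local potentials along a homotopy -/

section Potential

open Topology unitInterval Bundle

variable {X A V : Type*} [TopologicalSpace X] [TopologicalSpace A] [AddCommGroup V]

/-- The covering space of `X` determined by functions `F i` on open sets `W i ∋ i`, any two of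
which differ by a locally constant function: its points are the germs `F i + v` of potentials. -/
def potentialBundleCore [TopologicalSpace V] [DiscreteTopology V] (W : X → Set X)
    (hW : ∀ i, IsOpen (W i)) (hmem : ∀ i, i ∈ W i) (F : X → X → V)
    (hF : ∀ i j, ∀ x ∈ W i ∩ W j, ∀ᶠ y in 𝓝 x, F i y - F j y = F i x - F j x) :
    FiberBundleCore X X V where
  baseSet := W
  isOpen_baseSet := hW
  indexAt := id
  mem_baseSet_at := hmem
  coordChange i j x v := v + (F i x - F j x)
  coordChange_self i x _ v := by simp
  continuousOn_coordChange i j := by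
    rintro ⟨x, v⟩ ⟨hx, -⟩
    refine ContinuousAt.continuousWithinAt ?_
    have h1 : ContinuousAt (fun p : X × V => p.2 + (F i x - F j x)) (x, v) :=
      ((continuous_of_discreteTopology (f := fun v : V => v + (F i x - F j x))).comp
        continuous_snd).continuousAt
    refine h1.congr ?_
    filter_upwards [continuousAt_fst.eventually (hF i j x hx)] with p hp
    rw [hp]
  coordChange_comp i j k x _ v := by abel

/-- Let local potentials `F i`, defined on open sets `W i ∋ i` of `X`, pairwise differ by locally
constant functions. If they are locally constant along the initial map of a homotopy `c`, they
can be continued along `c` to a function vanishing initially. -/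
theorem exists_potential_along_homotopy (W : X → Set X)
    (hW : ∀ i, IsOpen (W i)) (hmem : ∀ i, i ∈ W i) (F : X → X → V)
    (hF : ∀ i j, ∀ x ∈ W i ∩ W j, ∀ᶠ y in 𝓝 x, F i y - F j y = F i x - F j x)
    (c : C(I × A, X))
    (h0 : ∀ a, ∀ᶠ b in 𝓝 a, F (c (0, a)) (c (0, b)) = F (c (0, a)) (c (0, a))) :
    ∃ h : I × A → V, (∀ a, h (0, a) = 0) ∧
      ∀ z i, c z ∈ W i → ∀ᶠ w in 𝓝 z, h w - F i (c w) = h z - F i (c z) := by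
  -- With discrete fibres the bundle of germs is a covering, and homotopies lift from an arbitrary
  -- space `A`.
  let _ : TopologicalSpace V := ⊥
  have : DiscreteTopology V := ⟨rfl⟩
  let Z := potentialBundleCore W hW hmem F hF
  have hcov : IsCoveringMap (π V Z.Fiber) := FiberBundle.isCoveringMap
  -- The initial germ at `c (0, a)` is the potential normalized to vanish there; `h0` is what makes
  -- this choice continuous.
  let f₀ : A → TotalSpace V Z.Fiber := fun a => ⟨c (0, a), (-F (c (0, a)) (c (0, a)) : V)⟩
  have hf₀ : Continuous f₀ := by
    refine continuous_iff_continuousAt.2 fun a => ?_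
    refine (FiberBundle.continuousAt_totalSpace V f₀).2
      ⟨(c.continuous.comp (Continuous.prodMk_right 0)).continuousAt, ?_⟩
    refine (continuousAt_const (y := -F (c (0, a)) (c (0, a)))).congr ?_
    filter_upwards [h0 a] with b hb
    change _ = -F (c (0, b)) (c (0, b)) + (F (c (0, b)) (c (0, b)) - F (c (0, a)) (c (0, b)))
    rw [hb]
    abel
  let Γ := hcov.liftHomotopy c ⟨f₀, hf₀⟩ (fun _ => rfl)
  have hproj : ∀ z, (Γ z).proj = c z := congrFun (hcov.liftHomotopy_lifts c ⟨f₀, hf₀⟩ fun _ => rfl)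
  have hzero : ∀ a, Γ (0, a) = f₀ a := hcov.liftHomotopy_zero c ⟨f₀, hf₀⟩ fun _ => rfl
  obtain ⟨coord, hcoord⟩ : ∃ coord : TotalSpace V Z.Fiber → V, ∀ e, coord e = e.2 :=
    ⟨fun e => e.2, fun _ => rfl⟩
  -- The function sought is the value of the lifted germ at its base point.
  refine ⟨fun z => coord (Γ z) + F (c z) (c z), fun a => ?_, fun z i hi => ?_⟩
  · dsimp only
    rw [hcoord, hzero]
    exact neg_add_cancel _
  · have h1 := ((FiberBundle.continuousAt_totalSpace V Γ).1 (Γ.continuous.continuousAt (x := z))).2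
    have h2 : ∀ᶠ w in 𝓝 z, coord (Γ w) + F (c w) (c w) - F (c z) (c w) =
        coord (Γ z) + F (c z) (c z) - F (c z) (c z) := by
      filter_upwards [h1.eventually (isOpen_discrete {_} |>.mem_nhds rfl)] with w hw
      have hw' : coord (Γ w) + (F (Γ w).proj (Γ w).proj - F (Γ z).proj (Γ w).proj) =
          coord (Γ z) + (F (Γ z).proj (Γ z).proj - F (Γ z).proj (Γ z).proj) := by
        rw [hcoord, hcoord]
        exact hw
      rwa [hproj, hproj, ← add_sub_assoc, ← add_sub_assoc] at hw'
    filter_upwards [h2, c.continuous.continuousAt.eventually (hF i (c z) (c z) ⟨hi, hmem _⟩)]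
      with w hw hw'
    have e1 : F i (c w) = F i (c z) - F (c z) (c z) + F (c z) (c w) := by rw [← hw']; abel
    rw [e1, sub_add_eq_sub_sub_swap, hw]
    abel

end Potential

/-! ### Smooth functions and closed 1-forms in charts -/

section Charts

open Topology Set MeasureTheory

variable {E : Type*} [NormedAddCommGroup E] [NormedSpace ℝ E]
  {M : Type*} [TopologicalSpace M] [ChartedSpace E M] [IsManifold 𝓘(ℝ, E) ∞ M]

lemma hasFDerivAt_comp_chartAt_symm {f : M → ℝ} {x y : M} (hy : y ∈ (chartAt E x).source)
    (hf : MDifferentiableAt 𝓘(ℝ, E) 𝓘(ℝ, ℝ) f y) :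
    HasFDerivAt (f ∘ (chartAt E x).symm)
      ((mvfderiv 𝓘(ℝ, E) f y).comp
        (mfderiv 𝓘(ℝ, E) 𝓘(ℝ, E) (chartAt E x).symm (chartAt E x y))) (chartAt E x y) := by
  have : IsManifold 𝓘(ℝ, E) 1 M := IsManifold.of_le (n := ∞) (by simp)
  have hsymm := (mdifferentiableAt_atlas_symm (I := 𝓘(ℝ, E)) (chart_mem_atlas E x)
    ((chartAt E x).map_source hy)).hasMFDerivAt
  have hf' : HasMFDerivAt 𝓘(ℝ, E) 𝓘(ℝ, ℝ) f ((chartAt E x).symm (chartAt E x y))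
      (mfderiv 𝓘(ℝ, E) 𝓘(ℝ, ℝ) f ((chartAt E x).symm (chartAt E x y))) := by
    refine MDifferentiableAt.hasMFDerivAt ?_
    rwa [(chartAt E x).left_inv hy]
  have h := hasMFDerivAt_iff_hasFDerivAt.1 (hf'.comp _ hsymm)
  rw [(chartAt E x).left_inv hy] at h
  exact h

/-- A function whose derivative vanishes near `x` is constant near `x`. -/
lemma eventually_eq_of_mvfderiv_eq_zero {f : M → ℝ} {x : M}
    (hf : ∀ᶠ y in 𝓝 x, MDifferentiableAt 𝓘(ℝ, E) 𝓘(ℝ, ℝ) f y ∧ mvfderiv 𝓘(ℝ, E) f y = 0) :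
    ∀ᶠ y in 𝓝 x, f y = f x := by
  set e := chartAt E x
  have hx : x ∈ e.source := mem_chart_source E x
  have h1 : ∀ᶠ y in 𝓝 x, HasFDerivAt (f ∘ e.symm) (0 : E →L[ℝ] ℝ) (e y) := by
    filter_upwards [hf, e.open_source.mem_nhds hx] with y hy hye
    have h := hasFDerivAt_comp_chartAt_symm hye hy.1
    rw [hy.2] at h
    exact h
  have h2 : ∀ᶠ z in 𝓝 (e x), HasFDerivAt (f ∘ e.symm) (0 : E →L[ℝ] ℝ) z := by
    rw [← e.map_nhds_eq hx]
    exact h1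
  obtain ⟨ε, hε, hball⟩ := Metric.eventually_nhds_iff_ball.1 h2
  filter_upwards [e.open_source.mem_nhds hx,
    (e.continuousAt hx).preimage_mem_nhds (Metric.ball_mem_nhds (e x) hε)] with y hye hyb
  have := (convex_ball (e x) ε).is_const_of_fderivWithin_eq_zero (𝕜 := ℝ) (f := f ∘ e.symm)
    (fun z hz => (hball z hz).differentiableAt.differentiableWithinAt)
    (fun z hz => (hball z hz).hasFDerivWithinAt.fderivWithin
      (Metric.isOpen_ball.uniqueDiffWithinAt hz)) hyb (Metric.mem_ball_self hε)
  simpa [e.left_inv hye, e.left_inv hx] using this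

/-- **Morse–Sard theorem** for a smooth real-valued function in a chart domain. -/
theorem volume_image_mvfderiv_eq_zero [FiniteDimensional ℝ E] {f : M → ℝ} {W : Set M} {x : M}
    (hW : IsOpen W) (hWx : W ⊆ (chartAt E x).source) (hf : ContMDiffOn 𝓘(ℝ, E) 𝓘(ℝ, ℝ) ∞ f W) :
    volume (f '' {y ∈ W | mvfderiv 𝓘(ℝ, E) f y = 0}) = 0 := by
  set e := chartAt E x
  have hO : IsOpen (e.target ∩ e.symm ⁻¹' W) := e.symm.isOpen_inter_preimage hW
  have hsm : ContDiffOn ℝ ∞ (f ∘ e.symm) (e.target ∩ e.symm ⁻¹' W) :=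
    (hf.comp ((contMDiffOn_chart_symm (I := 𝓘(ℝ, E)) (x := x)).mono inter_subset_left)
      fun z hz => hz.2).contDiffOn
  refine measure_mono_null ?_ (volume_image_fderiv_eq_zero hO hsm)
  rintro _ ⟨y, ⟨hyW, hy⟩, rfl⟩
  have hye : y ∈ e.source := hWx hyW
  refine ⟨e y, ⟨⟨e.map_source hye, ?_⟩, ?_⟩, ?_⟩
  · simpa [e.left_inv hye] using hyW
  · have h := hasFDerivAt_comp_chartAt_symm hye
      ((hf.contMDiffAt (hW.mem_nhds hyW)).mdifferentiableAt (by simp))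
    rw [hy] at h
    have h0 : HasFDerivAt (f ∘ e.symm) (0 : E →L[ℝ] ℝ) (e y) := h
    exact h0.fderiv
  · simp [e.left_inv hye]

/-! ### One-forms in charts and the Poincaré lemma -/

namespace EtaleLieGroupoid

/-- Smoothness of a form refers to the cotangent bundle, closedness to charts; this identifies the
two coordinate expressions. -/
lemma trivializationAt_formInChart (η : ∀ x : M, TangentSpace 𝓘(ℝ, E) x →L[ℝ] ℝ) {x y : M}
    (hy : y ∈ (chartAt E x).source) :
    (trivializationAt (E →L[ℝ] ℝ) (fun x : M => TangentSpace 𝓘(ℝ, E) x →L[ℝ] ℝ) x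
      (Bundle.TotalSpace.mk' (E →L[ℝ] ℝ)
        (E := fun x : M => TangentSpace 𝓘(ℝ, E) x →L[ℝ] ℝ) y (η y))).2 =
      formInChart η (chartAt E x) (chartAt E x y) := by
  have : IsManifold 𝓘(ℝ, E) 1 M := IsManifold.of_le (n := ∞) (by simp)
  erw [hom_trivializationAt_apply]
  simp only [ContinuousLinearMap.inCoordinates, formInChart]
  rw [TangentBundle.symmL_trivializationAt hy, (chartAt E x).left_inv hy]
  simp

lemma IsSmoothForm.contDiffOn_formInChart {η : ∀ x : M, TangentSpace 𝓘(ℝ, E) x →L[ℝ] ℝ}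
    (hη : IsSmoothForm η) (x : M) :
    ContDiffOn ℝ ∞ (formInChart η (chartAt E x)) (chartAt E x).target := by
  have hmaps : MapsTo (fun y => Bundle.TotalSpace.mk' (E →L[ℝ] ℝ)
      (E := fun x : M => TangentSpace 𝓘(ℝ, E) x →L[ℝ] ℝ) y (η y)) (chartAt E x).source
      (trivializationAt (E →L[ℝ] ℝ)
        (fun x : M => TangentSpace 𝓘(ℝ, E) x →L[ℝ] ℝ) x).source := by
    intro y hy
    rw [Bundle.Trivialization.mem_source]
    simpa using hy
  have h := ((Bundle.Trivialization.contMDiffOn_iff hmaps).1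
    (ContMDiff.contMDiffOn hη)).2
  have h' : ContMDiffOn 𝓘(ℝ, E) 𝓘(ℝ, E →L[ℝ] ℝ) ∞
      (fun y => formInChart η (chartAt E x) (chartAt E x y)) (chartAt E x).source :=
    h.congr fun y hy => (trivializationAt_formInChart η hy).symm
  refine ((h'.comp (contMDiffOn_chart_symm (x := x))
    (chartAt E x).mapsTo_symm).contDiffOn).congr fun z hz => ?_
  simp [(chartAt E x).right_inv hz]

/-- The exterior derivative of a 1-form is the antisymmetrization of its derivative, so closedness
becomes the symmetry required by the Poincaré lemma on a ball. -/
lemma IsClosedForm.fderiv_formInChart_symm {η : ∀ x : M, TangentSpace 𝓘(ℝ, E) x →L[ℝ] ℝ}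
    (hη : IsSmoothForm η) (hc : IsClosedForm η) (x : M) {z : E} (hz : z ∈ (chartAt E x).target)
    (a b : E) : fderiv ℝ (formInChart η (chartAt E x)) z a b =
      fderiv ℝ (formInChart η (chartAt E x)) z b a := by
  set θ := formInChart η (chartAt E x)
  have hθ : DifferentiableAt ℝ θ z := ((hη.contDiffOn_formInChart x).contDiffAt
    ((chartAt E x).open_target.mem_nhds hz)).differentiableAt (by simp)
  have hd : DifferentiableAt ℝ (fun z => ContinuousAlternatingMap.ofSubsingleton ℝ E ℝ (0 : Fin 1)
      (θ z)) z :=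
    (ContinuousAlternatingMap.ofSubsingletonLIE (𝕜 := ℝ) (E := E) (F := ℝ)
      (0 : Fin 1)).differentiableAt.comp z hθ
  have h := DFunLike.congr_fun (hc _ (chart_mem_atlas E x) z hz) ![a, b]
  rw [extDeriv_apply hd] at h
  have happ : ∀ v w : E, fderiv ℝ (fun z => θ z v) z w = fderiv ℝ θ z w v := fun v w => by
    rw [fderiv_clm_apply hθ (differentiableAt_const v)]
    simp
  simp [Fin.sum_univ_two, Fin.removeNth, happ] at h
  linarith

/-- A closed 1-form has local primitives. -/
theorem IsClosedForm.exists_local_primitive [FiniteDimensional ℝ E]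
    {η : ∀ x : M, TangentSpace 𝓘(ℝ, E) x →L[ℝ] ℝ}
    (hη : IsSmoothForm η) (hc : IsClosedForm η) (x : M) :
    ∃ (W : Set M) (F : M → ℝ), IsOpen W ∧ x ∈ W ∧ W ⊆ (chartAt E x).source ∧
      ContMDiffOn 𝓘(ℝ, E) 𝓘(ℝ, ℝ) ∞ F W ∧ ∀ y ∈ W, mvfderiv 𝓘(ℝ, E) F y = η y := by
  have : IsManifold 𝓘(ℝ, E) 1 M := IsManifold.of_le (n := ∞) (by simp)
  set e := chartAt E x
  have hx : x ∈ e.source := mem_chart_source E x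
  obtain ⟨ε, hε, hball⟩ := Metric.isOpen_iff.1 e.open_target (e x) (e.map_source hx)
  set B := Metric.ball (e x) ε
  have hθ := (hη.contDiffOn_formInChart x).mono hball
  obtain ⟨φ, hφ⟩ := (convex_ball (e x) ε).exists_forall_hasFDerivAt_of_fderiv_symmetric
    Metric.isOpen_ball (hθ.differentiableOn (by simp))
    (fun z hz a b => hc.fderiv_formInChart_symm hη x (hball hz) a b)
  have hφs : ContDiffOn ℝ ∞ φ B := by
    refine (contDiffOn_infty_iff_fderiv_of_isOpen Metric.isOpen_ball).2
      ⟨fun z hz => (hφ z hz).differentiableAt.differentiableWithinAt, ?_⟩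
    exact hθ.congr fun z hz => (hφ z hz).fderiv
  refine ⟨e.source ∩ e ⁻¹' B, φ ∘ e, e.isOpen_inter_preimage Metric.isOpen_ball,
    ⟨hx, Metric.mem_ball_self hε⟩, inter_subset_left, ?_, fun y hy => ?_⟩
  · exact hφs.contMDiffOn.comp ((contMDiffOn_chart (x := x)).mono inter_subset_left)
      fun y hy => hy.2
  · have he : MDifferentiableAt 𝓘(ℝ, E) 𝓘(ℝ, E) e y :=
      mdifferentiableAt_atlas (chart_mem_atlas E x) hy.1
    have hcomp := (HasMFDerivAt.comp y (hφ _ hy.2).hasMFDerivAt he.hasMFDerivAt).mfderiv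
    have hinv := (mdifferentiable_chart (I := 𝓘(ℝ, E)) x).symm_comp_deriv hy.1
    have : mvfderiv 𝓘(ℝ, E) (φ ∘ e) y =
        (formInChart η e (e y)).comp (mfderiv 𝓘(ℝ, E) 𝓘(ℝ, E) e y) := hcomp
    rw [this, formInChart, e.left_inv hy.1]
    change (η y).comp ((mfderiv 𝓘(ℝ, E) 𝓘(ℝ, E) e.symm (e y)).comp _) = _
    rw [hinv]
    rfl

end EtaleLieGroupoid

end Charts

/-! ### Invariant primitives near a neighborhood retract -/

/-- Two distinct points would force an interval of positive length. Combined with Morse–Sard, this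
replaces differentiation along a map that is only continuous. -/
lemma IsPreconnected.subsingleton_of_volume_eq_zero {s : Set ℝ} (hs : IsPreconnected s)
    (h0 : MeasureTheory.volume s = 0) : s.Subsingleton := by
  have key : ∀ a ∈ s, ∀ b ∈ s, b ≤ a := by
    intro a ha b hb
    by_contra! hlt
    have := MeasureTheory.measure_mono_null (hs.Icc_subset ha hb) h0
    rw [Real.volume_Icc, ENNReal.ofReal_eq_zero] at this
    linarith
  exact fun a ha b hb => le_antisymm (key b hb a ha) (key a ha b hb)

namespace EtaleLieGroupoid

open Topology Set unitInterval

variable {E : Type*} [NormedAddCommGroup E] [NormedSpace ℝ E]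
  {M : Type*} [TopologicalSpace M] [ChartedSpace E M]
  {G : Type*} [TopologicalSpace G] [ChartedSpace E G]
  {𝒢 : EtaleLieGroupoid E G M} {η : ∀ x : M, TangentSpace 𝓘(ℝ, E) x →L[ℝ] ℝ}

lemma proj_src_eq_proj_tgt (g : G) : 𝒢.proj (𝒢.src g) = 𝒢.proj (𝒢.tgt g) :=
  Quotient.sound ⟨g, rfl, rfl⟩

lemma exists_arrow_of_proj_eq {x y : M} (h : 𝒢.proj x = 𝒢.proj y) :
    ∃ g : G, 𝒢.src g = x ∧ 𝒢.tgt g = y :=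
  Quotient.exact h

lemma Subgroupoid.Hom.src_map_one {K L : 𝒢.Subgroupoid} (φ : K.Hom L) (x : K.objs) :
    𝒢.src (φ.map ⟨𝒢.one x, K.one_mem x x.2⟩ : G) = φ.obj x := by
  rw [φ.src_map]
  exact congrArg (fun x => (φ.obj x : M)) (Subtype.ext (𝒢.src_one x))

/-- Every arrow lies on a local section of the source map. -/
lemma exists_local_section_src (𝒢 : EtaleLieGroupoid E G M) (g : G) :
    ∃ s : M → G, s (𝒢.src g) = g ∧ ContMDiffAt 𝓘(ℝ, E) 𝓘(ℝ, E) ∞ s (𝒢.src g) ∧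
      ∀ᶠ z in 𝓝 (𝒢.src g), 𝒢.src (s z) = z := by
  obtain ⟨Φ, hg, hΦ⟩ := 𝒢.isLocalDiffeomorph_src g
  have hsrc : 𝒢.src g ∈ Φ.target := by
    rw [hΦ hg]
    exact Φ.map_source hg
  have hopen : Φ.target ∈ 𝓝 (𝒢.src g) := Φ.open_target.mem_nhds hsrc
  refine ⟨Φ.symm, ?_, Φ.contMDiffOn_invFun.contMDiffAt hopen, ?_⟩
  · rw [hΦ hg]
    exact Φ.left_inv hg
  · filter_upwards [hopen] with z hz
    exact (hΦ (Φ.map_target hz)).trans (Φ.right_inv hz)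

/-- A basic form at the source of an arrow is determined by its value at the target, through any
local section of the source map. -/
lemma IsBasicForm.eq_comp_section (hη : 𝒢.IsBasicForm η) {s : M → G} {y : M}
    (hs : ContMDiffAt 𝓘(ℝ, E) 𝓘(ℝ, E) ∞ s y) (hsec : ∀ᶠ z in 𝓝 y, 𝒢.src (s z) = z) :
    ((η (𝒢.tgt (s y))).comp (mfderiv 𝓘(ℝ, E) 𝓘(ℝ, E) 𝒢.tgt (s y))).comp
      (mfderiv 𝓘(ℝ, E) 𝓘(ℝ, E) s y) = η y := by
  have hy : 𝒢.src (s y) = y := hsec.self_of_nhds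
  have h1 : mfderiv 𝓘(ℝ, E) 𝓘(ℝ, E) (𝒢.src ∘ s) y =
      ContinuousLinearMap.id ℝ (TangentSpace 𝓘(ℝ, E) y) := by
    have : 𝒢.src ∘ s =ᶠ[𝓝 y] id := hsec
    rw [this.mfderiv_eq, mfderiv_id]
  rw [mfderiv_comp y ((𝒢.contMDiff_src _).mdifferentiableAt (by simp))
    (hs.mdifferentiableAt (by simp))] at h1
  rw [hη (s y)]
  change (η (𝒢.src (s y))).comp ((mfderiv 𝓘(ℝ, E) 𝓘(ℝ, E) 𝒢.src (s y)).comp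
    (mfderiv 𝓘(ℝ, E) 𝓘(ℝ, E) s y)) = η y
  rw [h1, hy]
  rfl

/-- A basic form vanishing at an object vanishes on its orbit. -/
lemma IsBasicForm.eq_zero_of_proj_eq (hη : 𝒢.IsBasicForm η) {x y : M} (hx : η x = 0)
    (h : 𝒢.proj y = 𝒢.proj x) : η y = 0 := by
  obtain ⟨g, rfl, rfl⟩ := exists_arrow_of_proj_eq h
  obtain ⟨s, hsg, hs, hsec⟩ := 𝒢.exists_local_section_src g
  rw [← hη.eq_comp_section hs hsec, hsg, hx, ContinuousLinearMap.zero_comp]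
  exact ContinuousLinearMap.zero_comp _

/-- The pull-backs of two primitives of a basic form along the target and the source differ by a
locally constant function on the arrows. -/
lemma IsBasicForm.eventually_sub_eq [IsManifold 𝓘(ℝ, E) ∞ G] (hη : 𝒢.IsBasicForm η) {W₁ W₂ : Set M} {F₁ F₂ : M → ℝ}
    (hW₁ : IsOpen W₁) (hW₂ : IsOpen W₂) (hF₁ : ContMDiffOn 𝓘(ℝ, E) 𝓘(ℝ, ℝ) ∞ F₁ W₁)
    (hF₂ : ContMDiffOn 𝓘(ℝ, E) 𝓘(ℝ, ℝ) ∞ F₂ W₂)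
    (hd₁ : ∀ y ∈ W₁, mvfderiv 𝓘(ℝ, E) F₁ y = η y) (hd₂ : ∀ y ∈ W₂, mvfderiv 𝓘(ℝ, E) F₂ y = η y)
    {g : G} (h₁ : 𝒢.tgt g ∈ W₁) (h₂ : 𝒢.src g ∈ W₂) :
    ∀ᶠ g' in 𝓝 g, F₁ (𝒢.tgt g') - F₂ (𝒢.src g') = F₁ (𝒢.tgt g) - F₂ (𝒢.src g) := by
  refine eventually_eq_of_mvfderiv_eq_zero (E := E)
    (f := fun g' => F₁ (𝒢.tgt g') - F₂ (𝒢.src g')) ?_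
  filter_upwards [𝒢.contMDiff_tgt.continuous.continuousAt.preimage_mem_nhds (hW₁.mem_nhds h₁),
    𝒢.contMDiff_src.continuous.continuousAt.preimage_mem_nhds (hW₂.mem_nhds h₂)] with k hk₁ hk₂
  have ht : MDifferentiableAt 𝓘(ℝ, E) 𝓘(ℝ, E) 𝒢.tgt k :=
    (𝒢.contMDiff_tgt k).mdifferentiableAt (by simp)
  have hs : MDifferentiableAt 𝓘(ℝ, E) 𝓘(ℝ, E) 𝒢.src k :=
    (𝒢.contMDiff_src k).mdifferentiableAt (by simp)
  have hm₁ : MDifferentiableAt 𝓘(ℝ, E) 𝓘(ℝ, ℝ) F₁ (𝒢.tgt k) :=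
    (hF₁.contMDiffAt (hW₁.mem_nhds hk₁)).mdifferentiableAt (by simp)
  have hm₂ : MDifferentiableAt 𝓘(ℝ, E) 𝓘(ℝ, ℝ) F₂ (𝒢.src k) :=
    (hF₂.contMDiffAt (hW₂.mem_nhds hk₂)).mdifferentiableAt (by simp)
  have hc₁ : MDifferentiableAt 𝓘(ℝ, E) 𝓘(ℝ, ℝ) (F₁ ∘ 𝒢.tgt) k := hm₁.comp k ht
  have hc₂ : MDifferentiableAt 𝓘(ℝ, E) 𝓘(ℝ, ℝ) (F₂ ∘ 𝒢.src) k := hm₂.comp k hs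
  refine ⟨hc₁.sub hc₂, ?_⟩
  have e₁ : mvfderiv 𝓘(ℝ, E) (F₁ ∘ 𝒢.tgt) k =
      (mvfderiv 𝓘(ℝ, E) F₁ (𝒢.tgt k)).comp (mfderiv 𝓘(ℝ, E) 𝓘(ℝ, E) 𝒢.tgt k) :=
    mfderiv_comp k hm₁ ht
  have e₂ : mvfderiv 𝓘(ℝ, E) (F₂ ∘ 𝒢.src) k =
      (mvfderiv 𝓘(ℝ, E) F₂ (𝒢.src k)).comp (mfderiv 𝓘(ℝ, E) 𝓘(ℝ, E) 𝒢.src k) :=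
    mfderiv_comp k hm₂ hs
  refine (mvfderiv_sub hc₁ hc₂).trans ?_
  rw [e₁, e₂, hd₁ _ hk₁, hd₂ _ hk₂, hη k, sub_self]

/-- An invariant primitive of a basic form on an open set `U` of objects descends to a primitive on
the image of `U` in the orbit space. -/
theorem IsBasicForm.isLocallyExactVanishing (hη : 𝒢.IsBasicForm η) {N U : Set M} (hU : IsOpen U)
    (hNU : N ⊆ U) (hN : ∀ x ∈ N, η x = 0) {f : M → ℝ}
    (hf : ContMDiffOn 𝓘(ℝ, E) 𝓘(ℝ, ℝ) ∞ f U) (hdf : ∀ x ∈ U, mvfderiv 𝓘(ℝ, E) f x = η x)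
    (hinv : ∀ g, 𝒢.src g ∈ U → 𝒢.tgt g ∈ U → f (𝒢.src g) = f (𝒢.tgt g)) :
    𝒢.IsLocallyExactVanishing η (𝒢.proj '' N) := by
  classical
  obtain ⟨F, hF⟩ : ∃ F : 𝒢.OrbitSpace → ℝ, ∀ x ∈ U, F (𝒢.proj x) = f x := by
    refine ⟨fun q => if h : ∃ x ∈ U, 𝒢.proj x = q then f h.choose else 0, fun x hx => ?_⟩
    have h : ∃ x' ∈ U, 𝒢.proj x' = 𝒢.proj x := ⟨x, hx, rfl⟩
    obtain ⟨g, hs, ht⟩ := exists_arrow_of_proj_eq h.choose_spec.2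
    dsimp only
    rw [dif_pos h, ← hs, ← ht]
    exact hinv g (hs ▸ h.choose_spec.1) (ht ▸ hx)
  -- The saturation of `U` is `src (tgt⁻¹ U)`, and `src` is open because the groupoid is étale.
  have hopen : IsOpen (𝒢.proj '' U) := by
    have hpre : 𝒢.proj ⁻¹' (𝒢.proj '' U) = 𝒢.src '' (𝒢.tgt ⁻¹' U) := by
      ext y
      constructor
      · rintro ⟨x, hx, hxy⟩
        obtain ⟨g, rfl, rfl⟩ := exists_arrow_of_proj_eq hxy.symm
        exact ⟨g, hx, rfl⟩
      · rintro ⟨g, hg, rfl⟩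
        exact ⟨𝒢.tgt g, hg, (proj_src_eq_proj_tgt g).symm⟩
    have : IsOpen (𝒢.proj ⁻¹' (𝒢.proj '' U)) := by
      rw [hpre]
      exact 𝒢.isLocalDiffeomorph_src.isOpenMap _ (hU.preimage 𝒢.contMDiff_tgt.continuous)
    exact isOpen_coinduced.2 this
  -- A point of the saturation is carried into `U` by an arrow. With a local section `s` of `src`
  -- through that arrow, `F ∘ 𝒢.proj` agrees near the point with `f ∘ tgt ∘ s`.
  have key : ∀ y ∈ 𝒢.proj ⁻¹' (𝒢.proj '' U),
      ContMDiffAt 𝓘(ℝ, E) 𝓘(ℝ, ℝ) ∞ (F ∘ 𝒢.proj) y ∧ mvfderiv 𝓘(ℝ, E) (F ∘ 𝒢.proj) y = η y := by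
    rintro y ⟨x, hx, hxy⟩
    obtain ⟨g, hgy, rfl⟩ := exists_arrow_of_proj_eq hxy.symm
    obtain ⟨s, hsg, hs, hsec⟩ := 𝒢.exists_local_section_src g
    rw [hgy] at hsg hs hsec
    subst hsg
    have hts : ContMDiffAt 𝓘(ℝ, E) 𝓘(ℝ, E) ∞ (𝒢.tgt ∘ s) y := (𝒢.contMDiff_tgt _).comp y hs
    have heq : F ∘ 𝒢.proj =ᶠ[𝓝 y] f ∘ (𝒢.tgt ∘ s) := by
      filter_upwards [hsec, hts.continuousAt.preimage_mem_nhds (hU.mem_nhds hx)] with z hz hzU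
      have : 𝒢.proj z = 𝒢.proj (𝒢.tgt (s z)) := by
        rw [← proj_src_eq_proj_tgt, hz]
      simp only [Function.comp_apply]
      rw [this]
      exact hF _ hzU
    have hfx : ContMDiffAt 𝓘(ℝ, E) 𝓘(ℝ, ℝ) ∞ f (𝒢.tgt (s y)) := hf.contMDiffAt (hU.mem_nhds hx)
    refine ⟨(ContMDiffAt.comp y hfx hts).congr_of_eventuallyEq heq, ?_⟩
    have e₁ : mvfderiv 𝓘(ℝ, E) (F ∘ 𝒢.proj) y =
        (mvfderiv 𝓘(ℝ, E) f (𝒢.tgt (s y))).comp (mfderiv 𝓘(ℝ, E) 𝓘(ℝ, E) (𝒢.tgt ∘ s) y) := by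
      refine Eq.trans ?_ (mfderiv_comp y (hfx.mdifferentiableAt (by simp))
        (hts.mdifferentiableAt (by simp)))
      exact heq.mfderiv_eq
    rw [e₁, hdf _ hx, mfderiv_comp y ((𝒢.contMDiff_tgt _).mdifferentiableAt (by simp))
      (hs.mdifferentiableAt (by simp))]
    exact hη.eq_comp_section hs hsec
  refine ⟨𝒢.proj '' U, hopen, image_mono hNU, F, fun y hy => (key y hy).1.contMDiffWithinAt,
    fun y hy => (key y hy).2.symm, fun y hy => ?_⟩
  rw [(key y (image_mono hNU hy)).2]
  obtain ⟨x, hx, hxy⟩ := hy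
  exact hη.eq_zero_of_proj_eq (hN x hx) hxy.symm

/-- Near a subgroupoid admitting a groupoid neighborhood retraction, a closed basic 1-form vanishing
at the objects of the subgroupoid has an invariant primitive. -/
theorem Subgroupoid.AdmitsNeighborhoodRetraction.exists_invariant_primitive
    [IsManifold 𝓘(ℝ, E) ∞ M] [IsManifold 𝓘(ℝ, E) ∞ G] [FiniteDimensional ℝ E] {H : 𝒢.Subgroupoid} (hret : H.AdmitsNeighborhoodRetraction)
    (hsmooth : IsSmoothForm η) (hclosed : IsClosedForm η) (hbasic : 𝒢.IsBasicForm η)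
    (hvan : ∀ x ∈ H.objs, η x = 0) :
    ∃ U : Set M, IsOpen U ∧ H.objs ⊆ U ∧ ∃ f : M → ℝ, ContMDiffOn 𝓘(ℝ, E) 𝓘(ℝ, ℝ) ∞ f U ∧
      (∀ x ∈ U, mvfderiv 𝓘(ℝ, E) f x = η x) ∧
      ∀ g, 𝒢.src g ∈ U → 𝒢.tgt g ∈ U → f (𝒢.src g) = f (𝒢.tgt g) := by
  classical
  obtain ⟨U, hNU, hU, r, -, D, hD, hD0, hD1⟩ := hret
  choose W F hWo hmem hWc hFs hFη using fun x => hclosed.exists_local_primitive hsmooth x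
  have hFF : ∀ i j, ∀ x ∈ W i ∩ W j, ∀ᶠ y in 𝓝 x, F i y - F j y = F i x - F j x := by
    intro i j x hx
    refine eventually_eq_of_mvfderiv_eq_zero (E := E) (f := fun y => F i y - F j y) ?_
    filter_upwards [(hWo i).mem_nhds hx.1, (hWo j).mem_nhds hx.2] with y hi hj
    have hmi := ((hFs i).contMDiffAt ((hWo i).mem_nhds hi)).mdifferentiableAt
      (by simp : (∞ : WithTop ℕ∞) ≠ 0)
    have hmj := ((hFs j).contMDiffAt ((hWo j).mem_nhds hj)).mdifferentiableAt
      (by simp : (∞ : WithTop ℕ∞) ≠ 0)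
    refine ⟨hmi.sub hmj, (mvfderiv_sub hmi hmj).trans ?_⟩
    rw [hFη i y hi, hFη j y hj, sub_self]
  -- Joint continuity of the homotopy is given on arrows only; on objects it is recovered through
  -- the units.
  have hDobj : Continuous fun p : I × U => ((D p.1).obj p.2 : M) := by
    have h1 : Continuous fun p : I × U =>
        (⟨𝒢.one p.2, (𝒢.restrict U).one_mem p.2 p.2.2⟩ : (𝒢.restrict U).arrows) :=
      (𝒢.contMDiff_one.continuous.comp
        (continuous_subtype_val.comp continuous_snd)).subtype_mk _
    have h2 := 𝒢.contMDiff_src.continuous.comp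
      (continuous_subtype_val.comp (hD.comp (continuous_fst.prodMk h1)))
    exact h2.congr fun p => (D p.1).src_map_one p.2
  -- Time is reversed so that the continuation starts in `H.objs`, where `η` vanishes, and ends at
  -- the inclusion of `U`.
  let c : C(I × U, M) := ⟨fun p => (D (σ p.1)).obj p.2,
    hDobj.comp ((continuous_symm.comp continuous_fst).prodMk continuous_snd)⟩
  have hc0 : ∀ a : U, c (0, a) ∈ H.objs := by
    intro a
    change ((D (σ 0)).obj a : M) ∈ H.objs
    rw [symm_zero, hD1]
    exact (r.obj a).2
  have hc1 : ∀ a : U, c (1, a) = a := by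
    intro a
    change ((D (σ 1)).obj a : M) = a
    rw [symm_one, hD0]
    rfl
  have : LocallyConnectedSpace M := ChartedSpace.locallyConnectedSpace E M
  have : LocallyConnectedSpace U := hU.locallyConnectedSpace
  -- On a connected neighborhood of `a`, the values of the primitive along `c (0, ·)` form a
  -- connected set of critical values, null by Morse–Sard and hence a single point.
  have hinit : ∀ a, ∀ᶠ b in 𝓝 a, F (c (0, a)) (c (0, b)) = F (c (0, a)) (c (0, a)) := by
    intro a
    set i := c (0, a)
    have hcont : Continuous fun b : U => c (0, b) := c.continuous.comp (Continuous.prodMk_right 0)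
    obtain ⟨B, ⟨hBo, haB, hBc⟩, hBW⟩ := (LocallyConnectedSpace.open_connected_basis a).mem_iff.1
      (hcont.continuousAt.preimage_mem_nhds ((hWo i).mem_nhds (hmem i)))
    have hpre : IsPreconnected ((fun b => F i (c (0, b))) '' B) :=
      hBc.isPreconnected.image _ ((hFs i).continuousOn.comp hcont.continuousOn fun b hb => hBW hb)
    have hnull : MeasureTheory.volume ((fun b => F i (c (0, b))) '' B) = 0 := by
      refine MeasureTheory.measure_mono_null ?_
        (volume_image_mvfderiv_eq_zero (hWo i) (hWc i) (hFs i))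
      rintro _ ⟨b, hb, rfl⟩
      refine ⟨c (0, b), ⟨hBW hb, ?_⟩, rfl⟩
      rw [hFη i _ (hBW hb)]
      exact hvan _ (hc0 b)
    filter_upwards [hBo.mem_nhds haB] with b hb
    exact hpre.subsingleton_of_volume_eq_zero hnull ⟨b, hb, rfl⟩ ⟨a, haB, rfl⟩
  obtain ⟨h, h0, hloc⟩ := exists_potential_along_homotopy W hWo hmem F hFF c hinit
  set f : M → ℝ := fun x => if hx : x ∈ U then h (1, ⟨x, hx⟩) else 0
  have hfU : ∀ a : U, f a = h (1, a) := fun a => dif_pos a.2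
  have hfloc : ∀ x ∈ U, f =ᶠ[𝓝 x] fun y => F x y + (f x - F x x) := by
    intro x hx
    have h1 := (Continuous.prodMk_right (1 : I)).continuousAt.eventually
      (hloc (1, (⟨x, hx⟩ : U)) x (by rw [hc1]; exact hmem x))
    rw [← hU.nhdsWithin_eq hx, Filter.EventuallyEq, ← map_nhds_subtype_val (⟨x, hx⟩ : U),
      Filter.eventually_map]
    filter_upwards [h1] with b hb
    rw [hc1, hc1, ← hfU, ← hfU] at hb
    linear_combination hb
  have hmd : ∀ x, ContMDiffAt 𝓘(ℝ, E) 𝓘(ℝ, ℝ) ∞ (F x) x := fun x =>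
    (hFs x).contMDiffAt ((hWo x).mem_nhds (hmem x))
  refine ⟨U, hU, hNU, f, fun x hx => ?_, fun x hx => ?_, fun g hgs hgt => ?_⟩
  · exact (((hmd x).add contMDiffAt_const).congr_of_eventuallyEq (hfloc x hx)).contMDiffWithinAt
  · have hx1 : mvfderiv 𝓘(ℝ, E) f x = mvfderiv 𝓘(ℝ, E) (fun y => F x y + (f x - F x x)) x :=
      (hfloc x hx).mfderiv_eq
    have hk : MDifferentiableAt 𝓘(ℝ, E) 𝓘(ℝ, ℝ) (fun _ : M => f x - F x x) x :=
      mdifferentiableAt_const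
    have hx2 := mvfderiv_add ((hmd x).mdifferentiableAt (by simp)) hk
    rw [mvfderiv_const, add_zero, hFη x x (hmem x)] at hx2
    exact hx1.trans hx2
  · set γ : (𝒢.restrict U).arrows := ⟨g, hgs, hgt⟩
    set a : U := ⟨𝒢.src g, hgs⟩
    set b : U := ⟨𝒢.tgt g, hgt⟩
    have hsrc : ∀ t, 𝒢.src ((D (σ t)).map γ : G) = c (t, a) := fun t => (D (σ t)).src_map γ
    have htgt : ∀ t, 𝒢.tgt ((D (σ t)).map γ : G) = c (t, b) := fun t => (D (σ t)).tgt_map γ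
    have hγ : Continuous fun t : I => ((D (σ t)).map γ : G) :=
      continuous_subtype_val.comp (hD.comp (continuous_symm.prodMk continuous_const))
    -- The change of `h` at either endpoint is that of a local primitive, and along the path of
    -- arrows `(D (σ t)).map γ` the two changes agree because `η` is basic.
    have hconst : IsLocallyConstant fun t : I => h (t, b) - h (t, a) := by
      refine (IsLocallyConstant.iff_eventually_eq _).2 fun t => ?_
      have hb := (Continuous.prodMk_left b).continuousAt.eventually (hloc (t, b) _ (hmem _))
      have ha := (Continuous.prodMk_left a).continuousAt.eventually (hloc (t, a) _ (hmem _))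
      have hg := hγ.continuousAt.eventually (hbasic.eventually_sub_eq (hWo (c (t, b)))
        (hWo (c (t, a))) (hFs _) (hFs _) (hFη _) (hFη _) (g := ((D (σ t)).map γ : G))
        (by rw [htgt]; exact hmem _) (by rw [hsrc]; exact hmem _))
      filter_upwards [ha, hb, hg] with t' ha' hb' hg'
      rw [htgt, htgt, hsrc, hsrc] at hg'
      linear_combination hb' - ha' + hg'
    have h01 := hconst.apply_eq_of_isPreconnected isPreconnected_univ (mem_univ 1) (mem_univ 0)
    simp only [h0, sub_self] at h01
    change f (a : M) = f (b : M)
    rw [hfU, hfU]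
    linarith

end EtaleLieGroupoid

/-! ### The equivalence of the two conditions -/

theorem mainTheorem5
    {E : Type*} [NormedAddCommGroup E] [NormedSpace ℝ E] [FiniteDimensional ℝ E]
    {M : Type*} [TopologicalSpace M] [T2Space M] [SecondCountableTopology M]
    [ChartedSpace E M] [IsManifold 𝓘(ℝ, E) ∞ M]
    {G : Type*} [TopologicalSpace G] [T2Space G] [SecondCountableTopology G]
    [ChartedSpace E G] [IsManifold 𝓘(ℝ, E) ∞ G]
    (𝒢 : EtaleLieGroupoid E G M) (h𝒢 : 𝒢.IsProper)
    (Y : Set 𝒢.OrbitSpace) (hY : IsClosed Y)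
    (H : 𝒢.Subgroupoid) (hN : IsClosed H.objs) (hHY : 𝒢.proj '' H.objs = Y)
    (hret : H.AdmitsNeighborhoodRetraction)
    (η : ∀ x : M, TangentSpace 𝓘(ℝ, E) x →L[ℝ] ℝ)
    (hsmooth : EtaleLieGroupoid.IsSmoothForm η)
    (hclosed : EtaleLieGroupoid.IsClosedForm η)
    (hbasic : 𝒢.IsBasicForm η) :
    𝒢.IsLocallyExactVanishing η Y ↔ ∀ x ∈ H.objs, η x = 0 := by
  subst hHY
  constructor
  · rintro ⟨V, -, hYV, f, -, hdf, hzero⟩ x hx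
    have hxY : 𝒢.proj x ∈ 𝒢.proj '' H.objs := ⟨x, hx, rfl⟩
    rw [hdf x (hYV hxY), hzero x hxY]
  · intro hvan
    obtain ⟨U, hU, hNU, f, hf, hdf, hinv⟩ :=
      hret.exists_invariant_primitive hsmooth hclosed hbasic hvan
    exact hbasic.isLocallyExactVanishing hU hNU hvan hf hdf hinv
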